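/- A sequential game $G=\langle N,A,H,O,d,p,(\prec_i)_{i\in N}\rangle$ consists of a non-empty finite set $N$ of players, a non-empty finite set $A$ of actions, a finite prefix-closed set $H$ of finite sequences over $A$ with $\varepsilon\in H$ (the nodes; $Z\subseteq H$ is the set of terminal nodes, those $h\in H$ with $ha\notin H$ for all $a\in A$), a non-empty set $O$ of outcomes, maps $d:H\setminus Z\to N$ (the owner of a node) and $p:Z\to O$, and for each $i\in N$ an arbitrary binary relation $\prec_i$ on $O$. A strategy profile $s=(s_i)_{i\in N}$ assigns to every $i\in N$ a map $s_i:d^{-1}(i)\to A$ with $hs_i(h)\in H$ for all $h\in d^{-1}(i)$; write $s(h)=s_{d(h)}(h)$. A node $a^1\cdots a^k\in H$ lies along the play induced by $s$ if $s(a^1\cdots a^{\ell})=a^{\ell+1}$ for all $0\le \ell<k$; the outcome $\langle s\rangle$ is $p(z)$ for the unique $z\in Z$ that lies along the play induced by $s$. For $h\in H\setminus Z$, $s|_h$ denotes the profile $h'\mapsto s(hh')$ in the subgame of $G$ rooted at $h$. For profiles $s,s'$ let $H(s,s')=\{h\in H\setminus Z : s(h)\neq s'(h)\}$. A player $i$ is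 cyclic if there are $k\ge 1$ and $x_1,\dots,x_k\in O$ with $x_1\prec_i x_2\prec_i\cdots\prec_i x_k\prec_i x_1$, and acyclic otherwise; $N_c$ and $N_r$ denote the sets of cyclic and of acyclic players, so that $N=N_r\uplus N_c$. Write $s\rightsquigarrow s'$ if one of the following holds: 1. ($\{SI\}$-dynamics) $\langle s|_h\rangle\prec_{d(h)}\langle s'|_h\rangle$ for every $h\in H(s,s')$, and $d(H(s,s'))\cap N_c=\emptyset$; 2. ($\{I,L,1P\}$-dynamics) $\langle s\rangle\prec_i\langle s'\rangle$ for every $i\in N$ with $s_i\neq s'_i$; every $h\in H(s,s')$ lies along the play induced by $s'$; there is $i\in N$ with $s_j=s'_j$ for all $j\neq i$; and $d(H(s,s'))\subseteq N_c$. Proposition. Let $N$, $O$ and $(\prec_i)_{i\in N}$ be given. Then in every game built over $N,O,(\prec_i)_{i\in N}$ the dynamics $\rightsquigarrow$ terminates for acyclic players: there is no infinite sequence $(s^k)_{k\in\mathbb N}$ of strategy profiles such that $s^k\rightsquigarrow s^{k+1}$ for all $k\in\mathbb N$ and, for every $j\in\mathbb N$, there is $k>j$ with $d(H(s^k,s^{k+1}))\cap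 N_r\neq\emptyset$. -/

import Mathlib

/-- The terminal nodes of a tree `H` of finite sequences: the members of `H` that no action
extends inside `H`. -/
def terminalNodes {A : Type*} (H : Set (List A)) : Set (List A) :=
  {h | h ∈ H ∧ ∀ a : A, h ++ [a] ∉ H}

/-- A sequential (extensive form) game with players `N`, actions `A` and outcomes `O`, played on a
finite prefix-closed set of sequences of actions. Finiteness and non-emptiness of `N` and `A`, and
non-emptiness of `O`, are assumed where games are quantified over. -/
structure SeqGame (N A O : Type*) where
  /-- the nodes -/
  H : Set (List A)
  finite_H : H.Finite
  nil_mem : [] ∈ H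
  prefix_closed : ∀ h h' : List A, h' <+: h → h ∈ H → h' ∈ H
  /-- the player who owns a nonterminal node -/
  d : ↥(H \ terminalNodes H) → N
  /-- the outcome of a terminal node -/
  p : ↥(terminalNodes H) → O
  /-- `prec i x y` means that player `i` strictly prefers `y` to `x` -/
  prec : N → O → O → Prop

namespace SeqGame

variable {N A O : Type*}

/-- The nonterminal nodes. -/
abbrev Inner (G : SeqGame N A O) : Type _ := ↥(G.H \ terminalNodes G.H)

/-- The nonterminal nodes that belong to player `i`. -/
abbrev InnerOf (G : SeqGame N A O) (i : N) : Type _ := {h : G.Inner // G.d h = i}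

/-- A strategy of player `i`: a legal action at each node of player `i`. -/
def Strategy (G : SeqGame N A O) (i : N) : Type _ :=
  {f : G.InnerOf i → A // ∀ h : G.InnerOf i, h.1.1 ++ [f h] ∈ G.H}

/-- A strategy profile: one strategy for each player. -/
def Profile (G : SeqGame N A O) : Type _ := ∀ i : N, G.Strategy i

/-- The action `s(h)` that the owner of the nonterminal node `h` plays there according to `s`. -/
def Profile.act {G : SeqGame N A O} (s : G.Profile) (h : G.Inner) : A :=
  (s (G.d h)).1 ⟨h, rfl⟩

/-- The sequence `h` lies along the play induced by `s`: every action in `h` is the one that `s`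
prescribes at the preceding node. The root always lies along the play. -/
def Profile.LiesAlong {G : SeqGame N A O} (s : G.Profile) (h : List A) : Prop :=
  ∀ (g : G.Inner) (a : A), g.1 ++ [a] <+: h → s.act g = a

theorem Profile.act_legal {G : SeqGame N A O} (s : G.Profile) (h : G.Inner) :
    h.1 ++ [s.act h] ∈ G.H :=
  (s (G.d h)).2 ⟨h, rfl⟩

/-- Any two nodes along the same play are comparable. -/
theorem Profile.LiesAlong.prefix_of_length_le {G : SeqGame N A O} {s : G.Profile} :
    ∀ {h h' : List A}, h ∈ G.H → h' ∈ G.H → s.LiesAlong h → s.LiesAlong h' →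
      h.length ≤ h'.length → h <+: h' := by
  intro h
  induction h using List.reverseRecOn with
  | nil => intro h' _ _ _ _ _; exact List.nil_prefix
  | append_singleton g a ih =>
    intro h' hm hm' hs hs' hl
    have hgp : g <+: g ++ [a] := List.prefix_append _ _
    have hgm : g ∈ G.H := G.prefix_closed _ _ hgp hm
    have hl' : g.length < h'.length := by simp at hl; omega
    obtain ⟨t, rfl⟩ := ih hgm hm' (fun k b hk => hs k b (hk.trans hgp)) hs' hl'.le
    cases t with
    | nil => simp at hl'
    | cons b t =>
      have hb : g ++ [b] <+: g ++ b :: t := ⟨t, by simp⟩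
      let k : G.Inner := ⟨g, hgm, fun hk => hk.2 a hm⟩
      have h1 : s.act k = a := hs k a List.prefix_rfl
      have h2 : s.act k = b := hs' k b hb
      rw [← h1, h2]
      exact hb

/-- Exactly one terminal node lies along the play induced by a strategy profile. -/
theorem Profile.existsUnique_terminal {G : SeqGame N A O} (s : G.Profile) :
    ∃! z : ↥(terminalNodes G.H), s.LiesAlong z.1 := by
  obtain ⟨z, ⟨hzm, hzs⟩, hmax⟩ := Set.exists_max_image {h | h ∈ G.H ∧ s.LiesAlong h} List.length
    (G.finite_H.subset fun _ h => h.1) ⟨[], G.nil_mem, fun g a h => by simp at h⟩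
  have hzt : z ∈ terminalNodes G.H := by
    by_contra hz
    let k : G.Inner := ⟨z, hzm, hz⟩
    have := hmax (z ++ [s.act k]) ⟨s.act_legal k, fun g a hg => by
      rcases List.prefix_concat_iff.1 hg with h | h
      · obtain ⟨h1, h2⟩ := List.append_inj' h rfl
        have : g = k := Subtype.ext h1
        subst this
        simpa using h2.symm
      · exact hzs g a h⟩
    simp at this
  refine ⟨⟨z, hzt⟩, hzs, fun y hy => Subtype.ext ?_⟩
  have hyz := Profile.LiesAlong.prefix_of_length_le y.2.1 hzm hy hzs (hmax y.1 ⟨y.2.1, hy⟩)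
  obtain ⟨t, ht⟩ := hyz
  cases t with
  | nil => simpa using ht
  | cons a t =>
    exact absurd (G.prefix_closed _ _ ⟨t, by simp [← ht]⟩ hzm) (y.2.2 a)

/-- The outcome of `s`: the outcome of the terminal node along the play induced by `s`. -/
noncomputable def Profile.outcome {G : SeqGame N A O} (s : G.Profile) : O :=
  G.p s.existsUnique_terminal.choose

theorem append_mem_terminal {H : Set (List A)} {h h' : List A} :
    h' ∈ terminalNodes {g | h ++ g ∈ H} ↔ h ++ h' ∈ terminalNodes H := by
  simp [terminalNodes]

/-- The subgame `G|_h` rooted at the nonterminal node `h`. -/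
def subgame (G : SeqGame N A O) (h : G.Inner) : SeqGame N A O where
  H := {h' | h.1 ++ h' ∈ G.H}
  finite_H := G.finite_H.preimage (List.append_right_injective h.1).injOn
  nil_mem := by simpa using h.2.1
  prefix_closed := fun g g' hg hm =>
    G.prefix_closed _ _ ((List.prefix_append_right_inj h.1).2 hg) hm
  d := fun h' => G.d ⟨h.1 ++ h'.1, h'.2.1, fun ht => h'.2.2 (append_mem_terminal.2 ht)⟩
  p := fun z => G.p ⟨h.1 ++ z.1, append_mem_terminal.1 z.2⟩
  prec := G.prec

/-- The substrategy profile `s|_h`, a strategy profile of `G|_h`, with `s|_h(h') = s(hh')`. -/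
def Profile.restrict {G : SeqGame N A O} (s : G.Profile) (h : G.Inner) : (G.subgame h).Profile :=
  fun i => ⟨fun h' => (s i).1
      ⟨⟨h.1 ++ h'.1.1, h'.1.2.1, fun ht => h'.1.2.2 (append_mem_terminal.2 ht)⟩, h'.2⟩,
    fun h' => by
      have := (s i).2
        ⟨⟨h.1 ++ h'.1.1, h'.1.2.1, fun ht => h'.1.2.2 (append_mem_terminal.2 ht)⟩, h'.2⟩
      rwa [List.append_assoc] at this⟩

/-- `H(s,s')`: the nodes where `s` and `s'` prescribe different actions. -/
def changedNodes {G : SeqGame N A O} (s s' : G.Profile) : Set G.Inner :=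
  {h | s.act h ≠ s'.act h}

/-- `d(H(s,s'))`: the owners of the nodes where `s` and `s'` differ. -/
def changedPlayers {G : SeqGame N A O} (s s' : G.Profile) : Set N :=
  G.d '' changedNodes s s'

/-- Improvement Property `I`. -/
def Improvement {G : SeqGame N A O} (s s' : G.Profile) : Prop :=
  ∀ i : N, s i ≠ s' i → G.prec i s.outcome s'.outcome

/-- Subgame Improvement Property `SI`. -/
def SubgameImprovement {G : SeqGame N A O} (s s' : G.Profile) : Prop :=
  ∀ i : N, ∀ h ∈ changedNodes s s', G.d h = i →
    G.prec i (s.restrict h).outcome (s'.restrict h).outcome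

/-- Laziness Property `L`. -/
def Laziness {G : SeqGame N A O} (s s' : G.Profile) : Prop :=
  ∀ h ∈ changedNodes s s', s'.LiesAlong h.1

/-- One Player Property `1P`. -/
def OnePlayer {G : SeqGame N A O} (s s' : G.Profile) : Prop :=
  ∃ i : N, ∀ j : N, j ≠ i → s j = s' j

/-- The `{SI}`-Dynamics. -/
def SIDynamics {G : SeqGame N A O} (s s' : G.Profile) : Prop :=
  SubgameImprovement s s'

/-- The `{I, L, 1P}`-Dynamics (lazy improvement dynamics). -/
def LazyImprovementDynamics {G : SeqGame N A O} (s s' : G.Profile) : Prop :=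
  Improvement s s' ∧ Laziness s s' ∧ OnePlayer s s'

/-- The dynamics in which the players outside `Nc` follow the `{SI}`-Dynamics and the players in
`Nc` follow the `{I, L, 1P}`-Dynamics. -/
def MixedDynamics {G : SeqGame N A O} (Nc : Set N) (s s' : G.Profile) : Prop :=
  (SIDynamics s s' ∧ changedPlayers s s' ∩ Nc = ∅) ∨
    (LazyImprovementDynamics s s' ∧ changedPlayers s s' ⊆ Nc)

/-- The dynamics `R` terminates for the players in `Nr`: there is no infinite sequence of updates
in which players in `Nr` change infinitely often. -/
def TerminatesFor {G : SeqGame N A O} (R : G.Profile → G.Profile → Prop) (Nr : Set N) : Prop :=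
  ¬ ∃ s : ℕ → G.Profile, (∀ k, R (s k) (s (k + 1))) ∧
    ∀ j, ∃ k > j, (changedPlayers (s k) (s (k + 1)) ∩ Nr).Nonempty

end SeqGame

/-- A binary relation is cyclic if it has a cycle `x₁ ≺ x₂ ≺ ⋯ ≺ xₖ ≺ x₁` with `k ≥ 1`. -/
def IsCyclicRel {O : Type*} (r : O → O → Prop) : Prop :=
  ∃ x : O, Relation.TransGen r x x

/-- `N_c`: the players whose preference is cyclic. -/
def cyclicPlayers {N O : Type*} (prec : N → O → O → Prop) : Set N :=
  {i | IsCyclicRel (prec i)}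

/-- `N_r`: the players whose preference is acyclic. -/
def acyclicPlayers {N O : Type*} (prec : N → O → O → Prop) : Set N :=
  {i | ¬ IsCyclicRel (prec i)}

open Filter

namespace SeqGame

variable {N A O : Type*} {G : SeqGame N A O}

/-! Choices at nodes of acyclic players freeze from the leaves upwards. Let `h` be such a node, and
suppose that the acyclic nodes strictly below it no longer change. Its potential sums, over the
successors not chosen at `h`, the owner's rank of their values. If a step keeps the choice at `h`,
laziness confines cyclic changes below `h` to the chosen successor, so the potential is unchanged
(`potential_eq`). If a step changes the choice, no cyclic player moves, all successor values
persist, and a higher-ranked successor leaves the sum in exchange for a lower one (`potential_lt`).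
A natural number drops only finitely often, so `h` freezes too. The chosen successor must be left
out: cyclic players can change its value at will. -/

/-- The node `z` extends `g`, and every action in `z` after `g` is prescribed by `s`. -/
def Profile.LeadsTo (s : G.Profile) (g z : List A) : Prop :=
  g <+: z ∧ ∀ (k : G.Inner) (a : A), g <+: k.1 → k.1 ++ [a] <+: z → s.act k = a

theorem Profile.LeadsTo.congr {s s' : G.Profile} {g z : List A}
    (hs : ∀ k : G.Inner, g <+: k.1 → s.act k = s'.act k) (h : s.LeadsTo g z) :
    s'.LeadsTo g z :=
  ⟨h.1, fun k a hk hz => (hs k hk) ▸ h.2 k a hk hz⟩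

theorem Profile.LeadsTo.liesAlong_restrict {s : G.Profile} {h : G.Inner} {w : List A}
    (hw : s.LeadsTo h.1 (h.1 ++ w)) : (s.restrict h).LiesAlong w := by
  intro k a hk
  refine hw.2 ⟨h.1 ++ k.1, k.2.1, fun ht => k.2.2 (append_mem_terminal.2 ht)⟩ a
    (List.prefix_append _ _) ?_
  simpa [List.append_assoc] using (List.prefix_append_right_inj h.1).2 hk

theorem Profile.outcome_restrict_eq {s : G.Profile} {h : G.Inner} {z : ↥(terminalNodes G.H)}
    (hz : s.LeadsTo h.1 z.1) : (s.restrict h).outcome = G.p z := by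
  obtain ⟨z, hzt⟩ := z
  obtain ⟨w, rfl⟩ : ∃ w, h.1 ++ w = z := hz.1
  have hw : (s.restrict h).LiesAlong w := hz.liesAlong_restrict
  have huniq := (s.restrict h).existsUnique_terminal.unique
    (s.restrict h).existsUnique_terminal.choose_spec.1
    (y₂ := ⟨w, append_mem_terminal.2 hzt⟩) hw
  unfold Profile.outcome
  rw [huniq]
  rfl

theorem Profile.exists_leadsTo (s : G.Profile) {g : List A} (hg : g ∈ G.H) :
    ∃ z : ↥(terminalNodes G.H), s.LeadsTo g z.1 := by
  by_cases ht : g ∈ terminalNodes G.H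
  · refine ⟨⟨g, ht⟩, List.prefix_rfl, fun k a hk hz => ?_⟩
    have h1 := hk.length_le
    have h2 := hz.length_le
    simp at h2
    omega
  · obtain ⟨w, hw, -⟩ := (s.restrict ⟨g, hg, ht⟩).existsUnique_terminal
    refine ⟨⟨g ++ w.1, append_mem_terminal.1 w.2⟩, List.prefix_append _ _, ?_⟩
    rintro ⟨k, hkm⟩ a ⟨t, rfl⟩ hz
    refine hw ⟨t, hkm.1, fun h => hkm.2 (append_mem_terminal.1 h)⟩ a ?_
    rw [List.append_assoc] at hz
    exact (List.prefix_append_right_inj g).1 hz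

theorem Profile.LeadsTo.of_child {s : G.Profile} {h : G.Inner} {z : List A}
    (hz : s.LeadsTo (h.1 ++ [s.act h]) z) : s.LeadsTo h.1 z := by
  refine ⟨(List.prefix_append _ _).trans hz.1, fun k a hk hka => ?_⟩
  obtain ⟨t, ht⟩ := hk
  cases t with
  | nil =>
    have : h = k := Subtype.ext (by simpa using ht)
    subst this
    have := (List.prefix_of_prefix_length_le hz.1 hka (by simp)).eq_of_length (by simp)
    simpa using this
  | cons b t =>
    refine hz.2 k a ?_ hka
    have hb : h.1 ++ [b] <+: k.1 := ⟨t, by simp [← ht]⟩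
    have hbz : h.1 ++ [b] <+: z := hb.trans ((List.prefix_append _ _).trans hka)
    rwa [(List.prefix_of_prefix_length_le hz.1 hbz (by simp)).eq_of_length (by simp)]

/-! ### Values of nodes -/

section value

variable [Nonempty O]

/-- The outcome obtained by following `s` from the node `g` on. -/
noncomputable def Profile.value (s : G.Profile) (g : List A) : O :=
  Classical.epsilon fun o => ∃ z : ↥(terminalNodes G.H), s.LeadsTo g z.1 ∧ G.p z = o

/-- Also valid for `g` outside the tree, where both sides are the same default; hence the potential
may range over illegal actions. -/
theorem Profile.value_congr {s s' : G.Profile} {g : List A}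
    (hs : ∀ k : G.Inner, g <+: k.1 → s.act k = s'.act k) : s.value g = s'.value g := by
  have h : ∀ z, s.LeadsTo g z ↔ s'.LeadsTo g z := fun z =>
    ⟨fun h => h.congr hs, fun h => h.congr fun k hk => (hs k hk).symm⟩
  simp only [Profile.value, h]

theorem Profile.value_spec (s : G.Profile) {g : List A} (hg : g ∈ G.H) :
    ∃ z : ↥(terminalNodes G.H), s.LeadsTo g z.1 ∧ G.p z = s.value g := by
  obtain ⟨z, hz⟩ := s.exists_leadsTo hg
  exact Classical.epsilon_spec
    (p := fun o => ∃ z : ↥(terminalNodes G.H), s.LeadsTo g z.1 ∧ G.p z = o) ⟨_, z, hz, rfl⟩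

theorem Profile.outcome_restrict_eq_value (s : G.Profile) (h : G.Inner) :
    (s.restrict h).outcome = s.value (h.1 ++ [s.act h]) := by
  obtain ⟨z, hz, hv⟩ := s.value_spec (s.act_legal h)
  rw [← hv, Profile.outcome_restrict_eq hz.of_child]

end value

/-- The number of outcomes of `G` below `o` in the transitive closure of player `i`'s
preference. -/
noncomputable def rank (G : SeqGame N A O) (i : N) (o : O) : ℕ :=
  {x | x ∈ Set.range G.p ∧ Relation.TransGen (G.prec i) x o}.ncard

/-- By transitivity everything below `x` is below `y`, and acyclicity keeps `x` from being below
itself, so the inclusion is strict. Counting only outcomes attained in `G` keeps the sets finite. -/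
theorem rank_lt {i : N} (hi : ¬ IsCyclicRel (G.prec i)) {x y : O} (hx : x ∈ Set.range G.p)
    (hxy : G.prec i x y) : G.rank i x < G.rank i y := by
  have : Finite ↥(terminalNodes G.H) := (G.finite_H.subset fun _ h => h.1).to_subtype
  refine Set.ncard_lt_ncard (Set.ssubset_iff_subset_ne.2
    ⟨fun w hw => ⟨hw.1, hw.2.tail hxy⟩, fun he => ?_⟩)
    ((Set.finite_range G.p).subset fun _ h => h.1)
  have hmem : x ∈ {w | w ∈ Set.range G.p ∧ Relation.TransGen (G.prec i) w y} :=
    ⟨hx, .single hxy⟩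
  rw [← he] at hmem
  exact hi ⟨x, hmem.2⟩

/-- In a step of the mixed dynamics, the changed nodes of players in `Nc` lie along the new play. -/
theorem MixedDynamics.laziness {Nc : Set N} {s s' : G.Profile} (hs : MixedDynamics Nc s s')
    {g : G.Inner} (hg : s.act g ≠ s'.act g) (hc : G.d g ∈ Nc) : s'.LiesAlong g.1 := by
  rcases hs with hs | hs
  · exact absurd ⟨⟨g, hg, rfl⟩, hc⟩ (Set.eq_empty_iff_forall_notMem.1 hs.2 (G.d g))
  · exact hs.1.2.1 g hg

/-! ### The potential of a node -/

section potential

variable [Nonempty O] [Fintype A] [DecidableEq A]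

/-- The sum of the ranks, for the owner of `h`, of the values of the successors of `h` that `s`
does not choose. -/
noncomputable def Profile.potential (s : G.Profile) (h : G.Inner) : ℕ :=
  ∑ a ∈ Finset.univ.erase (s.act h), G.rank (G.d h) (s.value (h.1 ++ [a]))

theorem Profile.potential_eq {Nc : Set N} {s s' : G.Profile} {h : G.Inner}
    (hs : MixedDynamics Nc s s') (hh : s.act h = s'.act h)
    (hbelow : ∀ g : G.Inner, h.1 <+: g.1 → h ≠ g → G.d g ∉ Nc → s.act g = s'.act g) :
    s'.potential h = s.potential h := by
  unfold Profile.potential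
  rw [hh]
  refine Finset.sum_congr rfl fun a ha => ?_
  rw [Profile.value_congr fun g hg => ?_]
  by_contra hne
  have hpre : h.1 <+: g.1 := (List.prefix_append _ _).trans hg
  have hhg : h ≠ g := by
    rintro rfl
    simpa using hg.length_le
  by_cases hc : G.d g ∈ Nc
  -- A cyclic change at `g` puts `g` on the new play, which would then take the unchosen action `a`
  -- at `h`.
  · exact Finset.ne_of_mem_erase ha (hs.laziness (Ne.symm hne) hc h a hg).symm
  · exact hne (hbelow g hpre hhg hc).symm

theorem Profile.potential_lt {Nc : Set N} {s s' : G.Profile} {h : G.Inner}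
    (hi : ¬ IsCyclicRel (G.prec (G.d h))) (hN : G.d h ∉ Nc)
    (hs : MixedDynamics Nc s s') (hh : s.act h ≠ s'.act h)
    (hbelow : ∀ g : G.Inner, h.1 <+: g.1 → h ≠ g → G.d g ∉ Nc → s.act g = s'.act g) :
    s'.potential h < s.potential h := by
  obtain ⟨hSI, hdisj⟩ := hs.resolve_right fun hL => hN (hL.2 ⟨h, hh, rfl⟩)
  have hval : ∀ a, s'.value (h.1 ++ [a]) = s.value (h.1 ++ [a]) := fun a => by
    refine Profile.value_congr fun g hg => ?_
    by_contra hne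
    refine hne (hbelow g ((List.prefix_append _ _).trans hg) ?_ fun hc => ?_).symm
    · rintro rfl
      simpa using hg.length_le
    · exact Set.eq_empty_iff_forall_notMem.1 hdisj (G.d g) ⟨⟨g, Ne.symm hne, rfl⟩, hc⟩
  have hprec : G.prec (G.d h) (s.value (h.1 ++ [s.act h])) (s.value (h.1 ++ [s'.act h])) := by
    rw [← hval (s'.act h), ← Profile.outcome_restrict_eq_value,
      ← Profile.outcome_restrict_eq_value]
    exact hSI _ h hh rfl
  obtain ⟨z, -, hz⟩ := s.value_spec (s.act_legal h)
  have hlt := rank_lt hi ⟨z, hz⟩ hprec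
  -- Both potentials complete to the same sum over all actions, so a larger omitted term leaves a
  -- smaller potential.
  have h1 := Finset.add_sum_erase Finset.univ
    (fun a => G.rank (G.d h) (s.value (h.1 ++ [a]))) (Finset.mem_univ (s.act h))
  have h2 := Finset.add_sum_erase Finset.univ
    (fun a => G.rank (G.d h) (s.value (h.1 ++ [a]))) (Finset.mem_univ (s'.act h))
  simp only [Profile.potential, hval]
  omega

end potential

/-- A sequence of natural numbers that is eventually nonincreasing is eventually constant. -/
theorem eventually_succ_eq {f : ℕ → ℕ} (hf : ∀ᶠ k in atTop, f (k + 1) ≤ f k) :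
    ∀ᶠ k in atTop, f (k + 1) = f k := by
  obtain ⟨K, hK⟩ := eventually_atTop.1 hf
  have hanti : Antitone fun n => f (K + n) := antitone_nat_of_succ_le fun n => hK _ (Nat.le_add_right K n)
  obtain ⟨m, hm⟩ := WellFounded.has_min (wellFounded_lt (α := ℕ))
    (Set.range fun n => f (K + n)) ⟨_, 0, rfl⟩
  obtain ⟨⟨n, rfl⟩, hmin⟩ := hm
  refine eventually_atTop.2 ⟨K + n, fun k hk => ?_⟩
  obtain ⟨j, rfl⟩ := Nat.exists_eq_add_of_le hk
  have key : ∀ l, f (K + (n + l)) = f (K + n) := fun l =>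
    le_antisymm (hanti (Nat.le_add_right n l)) (not_lt.1 (hmin _ ⟨n + l, rfl⟩))
  have h1 := key j
  have h2 := key (j + 1)
  simp only [← add_assoc] at h1 h2
  rw [h1, h2]

/-- Along the mixed dynamics, the choice at each node of an acyclic player is eventually
constant. -/
theorem eventually_act_eq [Nonempty O] [Finite A] {s : ℕ → G.Profile}
    (hs : ∀ k, MixedDynamics (cyclicPlayers G.prec) (s k) (s (k + 1))) (h : G.Inner)
    (hh : G.d h ∉ cyclicPlayers G.prec) :
    ∀ᶠ k in atTop, (s k).act h = (s (k + 1)).act h := by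
  classical
  have := Fintype.ofFinite A
  have : Finite G.Inner := (G.finite_H.subset fun _ h => h.1).to_subtype
  -- A bound on node lengths turns induction from the leaves up into induction on `L - h.1.length`.
  obtain ⟨L, hL⟩ := (Set.finite_range fun g : G.Inner => g.1.length).bddAbove
  induction hn : L - h.1.length using Nat.strong_induction_on generalizing h with
  | _ n ih =>
    have hbelow : ∀ᶠ k in atTop, ∀ g : G.Inner, h.1 <+: g.1 → h ≠ g →
        G.d g ∉ cyclicPlayers G.prec → (s k).act g = (s (k + 1)).act g := by
      refine eventually_all.2 fun g => ?_
      by_cases hg : h.1 <+: g.1 ∧ h ≠ g ∧ G.d g ∉ cyclicPlayers G.prec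
      · have hlt : h.1.length < g.1.length := lt_of_le_of_ne hg.1.length_le
          fun he => hg.2.1 (Subtype.ext (hg.1.eq_of_length he))
        have hgL : g.1.length ≤ L := hL ⟨g, rfl⟩
        exact (ih _ (by omega) g hg.2.2 rfl).mono fun k hk _ _ _ => hk
      · exact .of_forall fun k h1 h2 h3 => absurd ⟨h1, h2, h3⟩ hg
    have hle : ∀ᶠ k in atTop, (s (k + 1)).potential h ≤ (s k).potential h := by
      filter_upwards [hbelow] with k hk
      by_cases hc : (s k).act h = (s (k + 1)).act h
      · exact (Profile.potential_eq (hs k) hc hk).le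
      · exact (Profile.potential_lt hh hh (hs k) hc hk).le
    filter_upwards [hbelow, eventually_succ_eq (f := fun k => (s k).potential h) hle] with k hk hEq
    by_contra hc
    exact (Profile.potential_lt hh hh (hs k) hc hk).ne hEq

end SeqGame

theorem mainTheorem5 {N O : Type*} [Finite N] [Nonempty N] [Nonempty O]
    (prec : N → O → O → Prop)
    {A : Type*} [Finite A] [Nonempty A] (G : SeqGame N A O) (hG : G.prec = prec) :
    SeqGame.TerminatesFor (G := G) (SeqGame.MixedDynamics (cyclicPlayers prec))
      (acyclicPlayers prec) := by
  subst hG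
  rintro ⟨s, hs, hinf⟩
  have : Finite G.Inner := (G.finite_H.subset fun _ h => h.1).to_subtype
  have hev : ∀ᶠ k in Filter.atTop, ∀ h : G.Inner, G.d h ∉ cyclicPlayers G.prec →
      (s k).act h = (s (k + 1)).act h :=
    Filter.eventually_all.2 fun h => by
      by_cases hh : G.d h ∈ cyclicPlayers G.prec
      · exact .of_forall fun k hk => absurd hh hk
      · exact (SeqGame.eventually_act_eq hs h hh).mono fun k hk _ => hk
  obtain ⟨K, hK⟩ := Filter.eventually_atTop.1 hev
  obtain ⟨k, hk, i, ⟨h, hne, rfl⟩, hi⟩ := hinf K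
  exact hne (hK k hk.le h hi)
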